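/- **Setting.** A (labeled, undirected) $r$-relational graph is $G=(V(G),R_1(G),\dots,R_r(G),\ell)$ with $V(G)$ finite, each $R_i(G)$ a set of two-element subsets of $V(G)$, and $\ell\colon V(G)\to\mathbb N$; $N_i(v)$ is the neighborhood of $v$ with respect to $R_i(G)$. Isomorphisms preserve all relations and the labels. For $\vec v\in V(G)^k$, $w\in V(G)$, $\theta_j(\vec v,w)$ is $\vec v$ with its $j$-th component replaced by $w$. The atomic types of $\vec v\in V(G)^k$ and $\vec w\in V(H)^k$ are equal iff $v_p=v_q\Leftrightarrow w_p=w_q$ and $\{v_p,v_q\}\in R_i(G)\Leftrightarrow\{w_p,w_q\}\in R_i(H)$ for all $p,q\in[k]$, $i\in[r]$. The *$k$-RLWL* computes colorings of $V(G)^k$: $C^{(0)}(\vec v)$ is the atomic type of $\vec v$, and $C^{(t+1)}(\vec v)=\big(C^{(t)}(\vec v),\,(\{\!\!\{(C^{(t)}(\theta_j(\vec v,w)),i)\mid i\in[r],\,w\in N_i(v_j)\}\!\!\})_{j\in[k]}\big)$. It distinguishes $G$ and $H$ if for some $t$ and some color $c$ the numbers of $k$-tuples of $G$ and of $H$ with $C^{(t)}=c$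 differ. A *$k$-RN* starts from features $h^{(0)}_{\vec v}\in\mathbb R^{d_0}$ that are consistent with the atomic type (equal for two tuples iff their atomic types are equal), and computes, for $t=1,\dots,T$, $$h^{(t)}_{\vec v}=\mathsf{UPD}^{(t)}\Big(h^{(t-1)}_{\vec v},\mathsf{AGG}^{(t)}\big((\{\!\!\{\phi(h^{(t-1)}_{\theta_j(\vec v,w)},z^{(t)}_i)\mid i\in[r],\,w\in N_i(v_j)\}\!\!\})_{j\in[k]}\big)\Big),$$ and $h_G=\mathsf{READOUT}(\{\!\!\{h^{(T)}_{\vec v}\mid\vec v\in V(G)^k\}\!\!\})$, where all features are real vectors of finite dimension (which may depend on the layer), $z_i^{(t)}$ is a real vector for each relation, and $\phi,\mathsf{UPD}^{(t)},\mathsf{AGG}^{(t)},\mathsf{READOUT}$ are arbitrary functions. It distinguishes $G$ and $H$ if $h_G\neq h_H$. For $n\ge1$ let $K_n$ be the complete graph on $\{0,\dots,n-1\}$ and let $E(v)$ be the set of its edges at $v$. The graph $\mathcal G_n$ has as vertices all $(v,S)$ with $v\in V(K_n)$ and $S\subseteq E(v)$ of even size, and $e^0,e^1$ for each $e\in E(K_n)$;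 its edges are $\{e^0,e^1\}$ for $e\in E(K_n)$ and, for $v\in e$, $\{(v,S),e^1\}$ if $e\in S$ and $\{(v,S),e^0\}$ if $e\notin S$. The graph $\mathcal H_n$ is defined in the same way, except that for $v=0$ the sets $S\subseteq E(0)$ of odd size are taken. **Proposition.** Let $k\ge2$ and $r\ge1$. Let $G$ and $H$ be the $r$-relational graphs on $V(\mathcal G_{k+2})$ and $V(\mathcal H_{k+2})$ with $R_i(G)=E(\mathcal G_{k+2})$ and $R_i(H)=E(\mathcal H_{k+2})$ for all $i\in[r]$, and all labels equal. Then 1. $G$ and $H$ are not isomorphic; 2. the $k$-RLWL does not distinguish $G$ and $H$, while the $(k+1)$-RLWL does; 3. no $k$-RN distinguishes $G$ and $H$, whatever the consistent initial features, the depth, the dimensions, $\phi$, $z_i^{(t)}$, $\mathsf{UPD}^{(t)}$, $\mathsf{AGG}^{(t)}$ and $\mathsf{READOUT}$; 4. for all consistent initial features there is a $(k+1)$-RN with these initial features that distinguishes $G$ and $H$. Moreover, for all $r$-relational graphs $G'$ and $H'$: if the $k$-RLWL distinguishes $G'$ and $H'$, so does the $(k+1)$-RLWL; and if some $k$-RN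 distinguishes them, then for all consistent initial features some $(k+1)$-RN with these initial features does. Hence the $k$-RLWL and the $k$-RN form a strict hierarchy in $k$. -/

import Mathlib

/-- A labeled, undirected multi-relational graph with `r` relations on the vertex set `V`. -/
structure MultiRelGraph (r : ℕ) (V : Type*) where
  rel : Fin r → SimpleGraph V
  label : V → ℕ

namespace MultiRelGraph

variable {r : ℕ} {V W : Type*}

/-- Isomorphism: a bijection of the vertices that preserves every relation and the labels. -/
def Isomorphic (G : MultiRelGraph r V) (H : MultiRelGraph r W) : Prop :=
  ∃ φ : V ≃ W, (∀ i u v, (G.rel i).Adj u v ↔ (H.rel i).Adj (φ u) (φ v)) ∧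
    ∀ v, H.label (φ v) = G.label v

/-- The multiset `{{ f i w | i ∈ [r], w ∈ N_i(u) }}`. -/
noncomputable def neighborMultiset [Fintype V] (G : MultiRelGraph r V) (u : V)
    {α : Type*} (f : Fin r → V → α) : Multiset α :=
  open Classical in
  ∑ i : Fin r, (Finset.univ.filter fun w => (G.rel i).Adj u w).val.map (f i)

end MultiRelGraph

/-- Values of the multi-relational atomic type of `k`-tuples: the equality pattern of the tuple
and, for each relation, its adjacency pattern. -/
abbrev AtomicType (k r : ℕ) : Type :=
  (Fin k → Fin k → Prop) × (Fin r → Fin k → Fin k → Prop)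

/-- The multi-relational atomic type of a tuple.  Two tuples (of the same graph or of two graphs)
have the same type iff `v p ↦ w p` is a partial isomorphism preserving all relations. -/
def MultiRelGraph.atp {k r : ℕ} {V : Type*} (G : MultiRelGraph r V) (v : Fin k → V) :
    AtomicType k r :=
  (fun p q => v p = v q, fun i p q => (G.rel i).Adj (v p) (v q))

/-! ### The multi-relational local `k`-WL -/

/-- The colors after `t` rounds: `C⁽⁰⁾` is the atomic type, and `C⁽ᵗ⁺¹⁾ = (C⁽ᵗ⁾, M⁽ᵗ⁾)`. -/
def RLWLColor (k r : ℕ) : ℕ → Type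
  | 0 => AtomicType k r
  | t + 1 => RLWLColor k r t × (Fin k → Multiset (RLWLColor k r t × Fin r))

/-- The coloring of `V(G)^k` computed by the `k`-RLWL after `t` rounds.
`Function.update v j w` replaces the `j`-th component of `v` by `w`. -/
noncomputable def MultiRelGraph.rlwl {k r : ℕ} {V : Type*} [Fintype V] (G : MultiRelGraph r V) :
    (t : ℕ) → (Fin k → V) → RLWLColor k r t
  | 0 => fun v => G.atp v
  | t + 1 => fun v =>
      (G.rlwl t v,
        fun j => G.neighborMultiset (v j) fun i w => (G.rlwl t (Function.update v j w), i))

/-- The `k`-RLWL distinguishes `G` and `H`: after some number of rounds, some color is attained by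
different numbers of `k`-tuples of `G` and of `H`. -/
def RLWLDistinguishes (k : ℕ) {r : ℕ} {V W : Type*} [Fintype V] [Fintype W]
    (G : MultiRelGraph r V) (H : MultiRelGraph r W) : Prop :=
  ∃ (t : ℕ) (c : RLWLColor k r t),
    {v : Fin k → V | G.rlwl t v = c}.ncard ≠ {w : Fin k → W | H.rlwl t w = c}.ncard

/-! ### Local `k`-order relational networks -/

/-- Initial features in `ℝ^d` that are consistent with the atomic type: tuples get the same
feature iff they have the same atomic type. -/
structure InitialEncoding (k r d : ℕ) where
  toFun : AtomicType k r → Fin d → ℝ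
  injective : Function.Injective toFun

/-- Dimension of the features after `t` layers, when the initial features have dimension `d₀` and
layer `t + 1` outputs features of dimension `e t`. -/
def layerDim (d₀ : ℕ) (e : ℕ → ℕ) : ℕ → ℕ
  | 0 => d₀
  | t + 1 => e t

/-- A `k`-RN for `r` relations with initial features of dimension `d₀`.  The index `t` of
`edgeFeature`, `agg` and `upd` refers to layer `t + 1`. -/
structure RN (k r d₀ : ℕ) where
  /-- number of layers -/
  depth : ℕ
  /-- output dimension of each layer -/
  outDim : ℕ → ℕ
  /-- dimension of the edge features of each layer -/
  edgeDim : ℕ → ℕ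
  /-- output dimension of the composition map -/
  compDim : ℕ → ℕ → ℕ
  /-- output dimension of the aggregation of each layer -/
  aggDim : ℕ → ℕ
  /-- dimension of the graph-level feature -/
  readoutDim : ℕ
  /-- the edge feature of each relation -/
  edgeFeature : (t : ℕ) → Fin r → Fin (edgeDim t) → ℝ
  /-- the composition map, the same one in all layers (given for each pair of dimensions, since
  the dimensions may vary from layer to layer) -/
  comp : (d b : ℕ) → (Fin d → ℝ) → (Fin b → ℝ) → Fin (compDim d b) → ℝ
  agg : (t : ℕ) →
    (Fin k → Multiset (Fin (compDim (layerDim d₀ outDim t) (edgeDim t)) → ℝ)) → Fin (aggDim t) → ℝ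
  upd : (t : ℕ) → (Fin (layerDim d₀ outDim t) → ℝ) → (Fin (aggDim t) → ℝ) →
    Fin (layerDim d₀ outDim (t + 1)) → ℝ
  readout : Multiset (Fin (layerDim d₀ outDim depth) → ℝ) → Fin readoutDim → ℝ

namespace RN

variable {k r d₀ : ℕ} {V W : Type*} [Fintype V] [Fintype W]

/-- The feature of each `k`-tuple after `t` layers. -/
noncomputable def feature (N : RN k r d₀) (ι : InitialEncoding k r d₀) (G : MultiRelGraph r V) :
    (t : ℕ) → (Fin k → V) → Fin (layerDim d₀ N.outDim t) → ℝ
  | 0 => fun v => ι.toFun (G.atp v)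
  | t + 1 => fun v =>
      N.upd t (N.feature ι G t v)
        (N.agg t fun j => G.neighborMultiset (v j) fun i w =>
          N.comp _ _ (N.feature ι G t (Function.update v j w)) (N.edgeFeature t i))

/-- The graph-level feature `h_G`: the readout of the multiset of all final tuple features. -/
noncomputable def output (N : RN k r d₀) (ι : InitialEncoding k r d₀) (G : MultiRelGraph r V) :
    Fin N.readoutDim → ℝ :=
  open Classical in
  N.readout ((Finset.univ : Finset (Fin k → V)).val.map (N.feature ι G N.depth))

/-- The network distinguishes `G` and `H`: it computes different graph-level features. -/
def Distinguishes (N : RN k r d₀) (ι : InitialEncoding k r d₀)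
    (G : MultiRelGraph r V) (H : MultiRelGraph r W) : Prop :=
  N.output ι G ≠ N.output ι H

end RN

/-! ### The graphs of Cai–Fürer–Immerman type over a complete graph -/

/-- Vertices of the construction over the complete graph on `n` vertices, twisted at the base
vertices in `tw`: the pairs `(v, S)`, with `S` a set of base edges incident to `v` that has an odd
number of elements if `v ∈ tw` and an even number otherwise, and two vertices `(e, true)`,
`(e, false)`, that is `e¹` and `e⁰`, for each base edge `e`. -/
abbrev CFIVertex (n : ℕ) (tw : Finset (Fin n)) : Type :=
  {p : Fin n × Finset (Sym2 (Fin n)) //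
    (∀ e ∈ p.2, e ∈ (⊤ : SimpleGraph (Fin n)).incidenceSet p.1) ∧ (Odd p.2.card ↔ p.1 ∈ tw)} ⊕
  ((⊤ : SimpleGraph (Fin n)).edgeSet × Bool)

noncomputable instance (n : ℕ) (tw : Finset (Fin n)) : Fintype (CFIVertex n tw) :=
  Fintype.ofFinite _

/-- Adjacency: `e¹ ~ e⁰`; for `v ∈ e`, `(v, S) ~ e¹` if `e ∈ S`, and `(v, S) ~ e⁰` if `e ∉ S`. -/
def cfiAdj {n : ℕ} {tw : Finset (Fin n)} : CFIVertex n tw → CFIVertex n tw → Prop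
  | .inl _, .inl _ => False
  | .inl p, .inr (e, b) => p.1.1 ∈ e.1 ∧ (b = true ↔ e.1 ∈ p.1.2)
  | .inr (e, b), .inl p => p.1.1 ∈ e.1 ∧ (b = true ↔ e.1 ∈ p.1.2)
  | .inr (e, b), .inr (e', b') => e = e' ∧ b ≠ b'

def cfiGraph (n : ℕ) (tw : Finset (Fin n)) : SimpleGraph (CFIVertex n tw) where
  Adj := cfiAdj
  symm := ⟨by
    rintro (p | ⟨e, b⟩) (q | ⟨e', b'⟩) h
    · exact h
    · exact h
    · exact h
    · exact ⟨h.1.symm, h.2.symm⟩⟩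
  loopless := ⟨by
    rintro (p | ⟨e, b⟩) h
    · exact h
    · exact h.2 rfl⟩

/-- The multi-relational version: all `r` relations are equal, all labels are equal. -/
def cfiMultiRel (r n : ℕ) (tw : Finset (Fin n)) : MultiRelGraph r (CFIVertex n tw) where
  rel := fun _ => cfiGraph n tw
  label := fun _ => 0

/-! ### Bisimulations and color counts. -/

namespace MultiRelGraph

variable {k r : ℕ} {V W : Type*} [Fintype V] [Fintype W]

/-! Call the vertices `(u, S)` gadget vertices over `u`. The two graphs differ by a parity defect
that can be moved around but not removed.

Against `k` pebbles: a flip of base edges gives a bijection of the two vertex sets that respects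
adjacency except between one gadget `a` and one base edge `f` (`IsTwist`). While `a` carries no
pebble, the fault is invisible. Before a pebble moves, some `a'` is free together with the edge
`aa'`, because the base has `k + 2` vertices; if the pebble lands over `a`, the fault moves to `a'`
(`TwistRel.step`). This is a bisimulation by bijections, so all colors agree
(`CFI.not_rlwlDistinguishes`).

With `k + 1` pebbles: stable colors determine which pairs are gadget vertices over distinct base
vertices that agree on the joining edge (`linked_of_stablyEquiv`). In the untwisted graph the `(u,
∅)` are pairwise linked. The pebbles cover all but two of them and an edge vertex between the
missing two; answering its moves to either of them produces `k + 2` pairwise linked vertices in the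
twisted graph. Double counting excludes this, since the number of twists there is odd
(`even_card_of_linked`).

Networks: every feature is a function of the color (`feature_eq_ofColor`). Conversely, all feature
and multiset spaces have at most continuum cardinality, so all maps of a network can be chosen
injective (`exists_injective_rn`). Hence networks distinguish exactly what the RLWL of the same
order does. Non-isomorphism follows as well, since isomorphic graphs are never distinguished. -/

theorem map_neighborMultiset (G : MultiRelGraph r V) (u : V) {α β : Type*} (f : Fin r → V → α)
    (g : α → β) :
    (G.neighborMultiset u f).map g = G.neighborMultiset u fun i w => g (f i w) := by
  classical
  unfold neighborMultiset
  rw [← Multiset.coe_mapAddMonoidHom, map_sum]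
  simp

theorem neighborMultiset_congr {G : MultiRelGraph r V} {H : MultiRelGraph r W} {u : V} {u' : W}
    {α : Type*} {f : Fin r → V → α} {f' : Fin r → W → α} (e : V ≃ W)
    (hadj : ∀ i x, (G.rel i).Adj u x ↔ (H.rel i).Adj u' (e x))
    (hf : ∀ i x, (G.rel i).Adj u x → f i x = f' i (e x)) :
    G.neighborMultiset u f = H.neighborMultiset u' f' := by
  classical
  unfold neighborMultiset
  refine Finset.sum_congr rfl fun i _ => ?_
  refine Multiset.map_eq_map_of_bij_of_nodup _ _ (Finset.nodup _) (Finset.nodup _)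
    (fun x _ => e x) ?_ ?_ ?_ ?_
  · intro x hx
    simpa using (hadj i x).1 (by simpa using hx)
  · intro x _ y _ h
    exact e.injective h
  · intro y hy
    refine ⟨e.symm y, ?_, by simp⟩
    simpa using (hadj i (e.symm y)).2 (by simpa using hy)
  · intro x hx
    exact hf i x (by simpa using hx)

/-- A bisimulation between tuples, whose back-and-forth steps are given by bijections of the
vertex sets, preserves all colors. -/
theorem rlwl_eq_of_bisim {G : MultiRelGraph r V} {H : MultiRelGraph r W}
    (R : (Fin k → V) → (Fin k → W) → Prop) (hatp : ∀ v w, R v w → G.atp v = H.atp w)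
    (hstep : ∀ v w, R v w → ∀ j, ∃ e : V ≃ W, ∀ i x,
      ((G.rel i).Adj (v j) x ↔ (H.rel i).Adj (w j) (e x)) ∧
      ((G.rel i).Adj (v j) x → R (Function.update v j x) (Function.update w j (e x)))) :
    ∀ t v w, R v w → G.rlwl t v = H.rlwl t w := by
  intro t
  induction t with
  | zero => exact hatp
  | succ t ih =>
    intro v w h
    refine Prod.ext (ih v w h) (funext fun j => ?_)
    obtain ⟨e, he⟩ := hstep v w h j
    exact neighborMultiset_congr e (fun i x => (he i x).1) fun i x hx => by
      rw [ih _ _ ((he i x).2 hx)]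

/-- The multiset of the colors of all tuples. -/
noncomputable def rlwlMultiset (k : ℕ) (G : MultiRelGraph r V) (t : ℕ) :
    Multiset (RLWLColor k r t) :=
  open Classical in (Finset.univ : Finset (Fin k → V)).val.map (G.rlwl t)

theorem count_rlwlMultiset [DecidableEq (RLWLColor k r t)] (G : MultiRelGraph r V)
    (c : RLWLColor k r t) :
    (G.rlwlMultiset k t).count c = {v : Fin k → V | G.rlwl t v = c}.ncard := by
  classical
  rw [rlwlMultiset, Multiset.count_map, ← Finset.filter_val, Finset.card_val,
    Set.ncard_eq_toFinset_card']
  congr 1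
  ext v
  simp [eq_comm]

theorem rlwlDistinguishes_iff {G : MultiRelGraph r V} {H : MultiRelGraph r W} :
    RLWLDistinguishes k G H ↔ ∃ t, G.rlwlMultiset k t ≠ H.rlwlMultiset k t := by
  classical
  unfold RLWLDistinguishes
  refine exists_congr fun t => ?_
  rw [ne_eq, Multiset.ext, not_forall]
  simp only [count_rlwlMultiset, ne_eq]

theorem not_rlwlDistinguishes_of_equiv {G : MultiRelGraph r V} {H : MultiRelGraph r W}
    (e : (Fin k → V) ≃ (Fin k → W)) (he : ∀ t v, G.rlwl t v = H.rlwl t (e v)) :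
    ¬ RLWLDistinguishes k G H := by
  rintro ⟨t, c, h⟩
  refine h (Set.ncard_congr (fun v _ => e v) ?_ ?_ ?_)
  · intro v hv
    exact (he t v).symm.trans hv
  · intro v v' _ _ h
    exact e.injective h
  · intro w hw
    refine ⟨e.symm w, ?_, by simp⟩
    simpa [he] using hw

theorem Isomorphic.not_rlwlDistinguishes {G : MultiRelGraph r V} {H : MultiRelGraph r W}
    (h : G.Isomorphic H) : ¬ RLWLDistinguishes k G H := by
  obtain ⟨φ, hφ, -⟩ := h
  refine not_rlwlDistinguishes_of_equiv (Equiv.arrowCongr (Equiv.refl (Fin k)) φ) fun t v => ?_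
  refine rlwl_eq_of_bisim (fun v w => w = φ ∘ v) ?_ ?_ t v _ rfl
  · rintro v _ rfl
    simp [atp, hφ]
  · rintro v _ rfl j
    exact ⟨φ, fun i x => ⟨hφ i _ _, fun _ => (Function.comp_update φ v j x).symm⟩⟩

/-! ### Passing from `k` to `k + 1` -/

end MultiRelGraph

/-- The color of the first `k` components of a `(k + 1)`-tuple. -/
def RLWLColor.init {k r : ℕ} : (t : ℕ) → RLWLColor (k + 1) r t → RLWLColor k r t
  | 0 => fun c => (fun p q => c.1 p.castSucc q.castSucc, fun i p q => c.2 i p.castSucc q.castSucc)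
  | t + 1 => fun c => (init t c.1, fun j => (c.2 j.castSucc).map (Prod.map (init t) id))

namespace MultiRelGraph

variable {k r : ℕ} {V W : Type*} [Fintype V] [Fintype W]

theorem init_rlwl (G : MultiRelGraph r V) (t : ℕ) (v : Fin (k + 1) → V) :
    RLWLColor.init t (G.rlwl t v) = G.rlwl t (Fin.init v) := by
  induction t generalizing v with
  | zero => rfl
  | succ t ih =>
    refine Prod.ext (ih v) (funext fun j => ?_)
    change Multiset.map _ (G.neighborMultiset _ _) = G.neighborMultiset _ _
    rw [map_neighborMultiset]
    simp [ih, Fin.init, Fin.init_update_castSucc]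

/-- Each `k`-tuple extends to a `(k + 1)`-tuple by an arbitrary last vertex, and the color of the
extension determines its own. -/
theorem map_init_rlwlMultiset (G : MultiRelGraph r V) (t : ℕ) :
    (G.rlwlMultiset (k + 1) t).map (RLWLColor.init t) =
      Fintype.card V • G.rlwlMultiset k t := by
  classical
  ext c
  rw [rlwlMultiset, Multiset.map_map, Multiset.count_nsmul, count_rlwlMultiset,
    Multiset.count_map, ← Finset.filter_val, Finset.card_val, ← Nat.card_eq_fintype_card,
    ← Nat.card_coe_set_eq, ← Nat.card_prod, ← Nat.card_eq_finsetCard]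
  refine Nat.card_congr ?_
  refine ((Fin.snocEquiv fun _ : Fin (k + 1) => V).symm.subtypeEquiv
    (q := fun p => G.rlwl t p.2 = c) ?_).trans ?_
  · intro v
    simp [init_rlwl, eq_comm, Fin.snocEquiv]
  · exact
    { toFun := fun p => (p.1.1, ⟨p.1.2, p.2⟩)
      invFun := fun p => ⟨(p.1, p.2.1), p.2.2⟩
      left_inv := fun _ => rfl
      right_inv := fun _ => rfl }

theorem card_rlwlMultiset (G : MultiRelGraph r V) (t : ℕ) :
    (G.rlwlMultiset k t).card = Fintype.card V ^ k := by
  classical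
  simp [rlwlMultiset]

theorem rlwlDistinguishes_succ (hk : k ≠ 0) {G : MultiRelGraph r V} {H : MultiRelGraph r W}
    (h : RLWLDistinguishes k G H) : RLWLDistinguishes (k + 1) G H := by
  classical
  rw [rlwlDistinguishes_iff] at h ⊢
  obtain ⟨t, ht⟩ := h
  refine ⟨t, fun heq => ht ?_⟩
  have hcard : Fintype.card V = Fintype.card W := by
    have := congrArg Multiset.card heq
    rw [card_rlwlMultiset, card_rlwlMultiset] at this
    exact Nat.pow_left_injective (Nat.succ_ne_zero k) this
  have hmap := congrArg (Multiset.map (RLWLColor.init t)) heq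
  rw [map_init_rlwlMultiset, map_init_rlwlMultiset, hcard] at hmap
  -- The factor `Fintype.card W` can be cancelled only if it is positive; without vertices there are
  -- no `k`-tuples, as `k ≠ 0`.
  rcases Nat.eq_zero_or_pos (Fintype.card W) with h0 | hpos
  · have h1 : (G.rlwlMultiset k t).card = 0 := by
      rw [card_rlwlMultiset, hcard, h0, zero_pow hk]
    have h2 : (H.rlwlMultiset k t).card = 0 := by
      rw [card_rlwlMultiset, h0, zero_pow hk]
    rw [Multiset.card_eq_zero.1 h1, Multiset.card_eq_zero.1 h2]
  · ext c
    have := congrArg (Multiset.count c) hmap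
    rw [Multiset.count_nsmul, Multiset.count_nsmul] at this
    exact Nat.eq_of_mul_eq_mul_left hpos this

end MultiRelGraph

/-! ### Relational networks and colors -/

namespace RN

open MultiRelGraph

variable {k r d₀ : ℕ} {V W : Type*} [Fintype V] [Fintype W]

/-- The feature that a network computes from a color. -/
noncomputable def ofColor (N : RN k r d₀) (ι : InitialEncoding k r d₀) :
    (t : ℕ) → RLWLColor k r t → Fin (layerDim d₀ N.outDim t) → ℝ
  | 0 => ι.toFun
  | t + 1 => fun c => N.upd t (N.ofColor ι t c.1) (N.agg t fun j =>
      (c.2 j).map fun p => N.comp _ _ (N.ofColor ι t p.1) (N.edgeFeature t p.2))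

theorem feature_eq_ofColor (N : RN k r d₀) (ι : InitialEncoding k r d₀) (G : MultiRelGraph r V)
    (t : ℕ) : N.feature ι G t = N.ofColor ι t ∘ G.rlwl t := by
  induction t with
  | zero => rfl
  | succ t ih =>
    funext v
    change N.upd t (N.feature ι G t v) (N.agg t _) = N.upd t (N.ofColor ι t (G.rlwl t v))
      (N.agg t fun j => Multiset.map _ (G.neighborMultiset _ _))
    simp only [map_neighborMultiset, ih, Function.comp_apply]

theorem output_eq (N : RN k r d₀) (ι : InitialEncoding k r d₀) (G : MultiRelGraph r V) :
    N.output ι G = N.readout ((G.rlwlMultiset k N.depth).map (N.ofColor ι N.depth)) := by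
  rw [output, feature_eq_ofColor, rlwlMultiset, Multiset.map_map]

theorem Distinguishes.rlwlDistinguishes {N : RN k r d₀} {ι : InitialEncoding k r d₀}
    {G : MultiRelGraph r V} {H : MultiRelGraph r W} (h : N.Distinguishes ι G H) :
    RLWLDistinguishes k G H := by
  rw [rlwlDistinguishes_iff]
  refine ⟨N.depth, fun heq => h ?_⟩
  rw [output_eq, output_eq, heq]

theorem exists_injective_real {α : Type} (h : Cardinal.mk α ≤ Cardinal.continuum) :
    ∃ f : α → Fin 1 → ℝ, Function.Injective f := by
  rw [← Cardinal.mk_real] at h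
  obtain ⟨f⟩ := h
  exact ⟨fun a _ => f a, fun a b hab => f.injective (congrFun hab 0)⟩

theorem mk_fin_fun_real_le (d : ℕ) : Cardinal.mk (Fin d → ℝ) ≤ Cardinal.continuum := by
  simp only [Cardinal.mk_pi, Cardinal.mk_real, Cardinal.prod_const, Cardinal.lift_id,
    Cardinal.mk_fin]
  exact Cardinal.power_nat_le Cardinal.aleph0_le_continuum

theorem mk_multiset_fin_fun_real_le (d : ℕ) :
    Cardinal.mk (Multiset (Fin d → ℝ)) ≤ Cardinal.continuum :=
  (Cardinal.mk_le_of_surjective (Quot.mk_surjective)).trans <|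
    (Cardinal.mk_list_le_max _).trans
      (max_le Cardinal.aleph0_le_continuum (mk_fin_fun_real_le d))

/-- A network all of whose functions are injective. -/
theorem exists_injective_rn (k r d₀ T : ℕ) (ι : InitialEncoding k r d₀) :
    ∃ N : RN k r d₀, N.depth = T ∧ Function.Injective N.readout ∧
      ∀ t, Function.Injective (N.ofColor ι t) := by
  have hagg : ∀ d : ℕ, ∃ f : (Fin k → Multiset (Fin d → ℝ)) → Fin 1 → ℝ,
      Function.Injective f := fun d => exists_injective_real <| by
    simp only [Cardinal.mk_pi, Cardinal.prod_const, Cardinal.lift_id, Cardinal.mk_fin]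
    exact (Cardinal.power_le_power_right (mk_multiset_fin_fun_real_le d)).trans
      (Cardinal.power_nat_le Cardinal.aleph0_le_continuum)
  have hupd : ∀ d : ℕ, ∃ f : (Fin d → ℝ) × (Fin 1 → ℝ) → Fin 1 → ℝ,
      Function.Injective f := fun d => exists_injective_real <| by
    rw [Cardinal.mk_prod, Cardinal.lift_id, Cardinal.lift_id]
    exact (mul_le_mul' (mk_fin_fun_real_le d) (mk_fin_fun_real_le 1)).trans
      Cardinal.continuum_mul_self.le
  have hread : ∀ d : ℕ, ∃ f : Multiset (Fin d → ℝ) → Fin 1 → ℝ,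
      Function.Injective f := fun d => exists_injective_real (mk_multiset_fin_fun_real_le d)
  choose agg hagg using hagg
  choose upd hupd using hupd
  choose read hread using hread
  -- Every layer outputs a single real number. The composition concatenates, so it is injective in
  -- all dimensions at once, and the edge feature is the index of the relation.
  let N : RN k r d₀ :=
    { depth := T
      outDim := fun _ => 1
      edgeDim := fun _ => 1
      compDim := fun d b => d + b
      aggDim := fun _ => 1
      readoutDim := 1
      edgeFeature := fun _ i _ => (i : ℕ)
      comp := fun _ _ x z => Fin.append x z
      agg := fun _ => agg _
      upd := fun _ x y => upd _ (x, y)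
      readout := read _ }
  refine ⟨N, rfl, hread _, fun t => ?_⟩
  induction t with
  | zero => exact ι.injective
  | succ t ih =>
    rintro ⟨c, M⟩ ⟨c', M'⟩ h
    have h1 := hupd _ h
    rw [Prod.mk.injEq] at h1
    have h2 := hagg _ h1.2
    refine Prod.ext (ih h1.1) (funext fun j => ?_)
    refine Multiset.map_injective ?_ (congrFun h2 j)
    rintro ⟨a, i⟩ ⟨a', i'⟩ hp
    have h3 : N.ofColor ι t a = N.ofColor ι t a' := funext fun x => by
      simpa [N] using congrFun hp (Fin.castAdd 1 x)
    have h4 : (i : ℝ) = (i' : ℝ) := by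
      simpa [N] using congrFun hp (Fin.natAdd _ (0 : Fin 1))
    exact Prod.ext (ih h3) (Fin.ext (by exact_mod_cast h4))

theorem exists_distinguishes {G : MultiRelGraph r V} {H : MultiRelGraph r W}
    (h : RLWLDistinguishes k G H) (ι : InitialEncoding k r d₀) :
    ∃ N : RN k r d₀, N.Distinguishes ι G H := by
  obtain ⟨t, ht⟩ := rlwlDistinguishes_iff.1 h
  obtain ⟨N, rfl, hread, hinj⟩ := exists_injective_rn k r d₀ t ι
  refine ⟨N, fun heq => ht ?_⟩
  rw [output_eq, output_eq] at heq
  exact Multiset.map_injective (hinj _) (hread heq)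

end RN

/-! ### Stable equivalence of tuples. -/

namespace MultiRelGraph

variable {k r : ℕ} {V W : Type*} [Fintype V] [Fintype W]

/-- The tuples get the same color in every round. -/
def StablyEquiv (G : MultiRelGraph r V) (H : MultiRelGraph r W) (v : Fin k → V) (w : Fin k → W) :
    Prop :=
  ∀ t, G.rlwl t v = H.rlwl t w

theorem rlwl_eq_of_le {G : MultiRelGraph r V} {H : MultiRelGraph r W} {v : Fin k → V}
    {w : Fin k → W} {s t : ℕ} (hst : s ≤ t) (h : G.rlwl t v = H.rlwl t w) :
    G.rlwl s v = H.rlwl s w := by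
  induction hst with
  | refl => exact h
  | step _ ih => exact ih (congrArg Prod.fst h)

/-- Colors only refine and there are finitely many pairs of tuples, so the maximum of their
separation times works. -/
theorem exists_stable_time (k : ℕ) (G : MultiRelGraph r V) (H : MultiRelGraph r W) :
    ∃ T, ∀ (v : Fin k → V) (w : Fin k → W), G.rlwl T v = H.rlwl T w → StablyEquiv G H v w := by
  classical
  have h : ∀ p : (Fin k → V) × (Fin k → W), ∃ t, G.rlwl t p.1 = H.rlwl t p.2 →
      StablyEquiv G H p.1 p.2 := by
    intro p
    by_cases hp : StablyEquiv G H p.1 p.2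
    · exact ⟨0, fun _ => hp⟩
    · obtain ⟨t, ht⟩ := not_forall.1 hp
      exact ⟨t, fun h => absurd h ht⟩
  choose τ hτ using h
  exact ⟨Finset.univ.sup τ, fun v w hvw =>
    hτ (v, w) (rlwl_eq_of_le (Finset.le_sup (Finset.mem_univ (v, w))) hvw)⟩

theorem exists_stablyEquiv {G : MultiRelGraph r V} {H : MultiRelGraph r W}
    (h : ¬ RLWLDistinguishes k G H) (v : Fin k → V) : ∃ w, StablyEquiv G H v w := by
  classical
  obtain ⟨T, hT⟩ := exists_stable_time k G H
  have hmem : G.rlwl T v ∈ H.rlwlMultiset k T := by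
    have : G.rlwlMultiset k T = H.rlwlMultiset k T := by
      by_contra hne
      exact h (rlwlDistinguishes_iff.2 ⟨T, hne⟩)
    rw [← this, rlwlMultiset]
    exact Multiset.mem_map_of_mem _ (Finset.mem_univ v)
  obtain ⟨w, -, hw⟩ := Multiset.mem_map.1 hmem
  exact ⟨w, hT v w hw.symm⟩

theorem StablyEquiv.symm {G : MultiRelGraph r V} {H : MultiRelGraph r W} {v : Fin k → V}
    {w : Fin k → W} (h : StablyEquiv G H v w) : StablyEquiv H G w v :=
  fun t => (h t).symm

theorem StablyEquiv.eq_iff {G : MultiRelGraph r V} {H : MultiRelGraph r W} {v : Fin k → V}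
    {w : Fin k → W} (h : StablyEquiv G H v w) (p q : Fin k) : v p = v q ↔ w p = w q :=
  iff_of_eq (congrFun (congrFun (congrArg Prod.fst (h 0)) p) q)

theorem StablyEquiv.adj_iff {G : MultiRelGraph r V} {H : MultiRelGraph r W} {v : Fin k → V}
    {w : Fin k → W} (h : StablyEquiv G H v w) (i : Fin r) (p q : Fin k) :
    (G.rel i).Adj (v p) (v q) ↔ (H.rel i).Adj (w p) (w q) :=
  iff_of_eq (congrFun (congrFun (congrFun (congrArg Prod.snd (h 0)) i) p) q)

/-- The tag `i` keeps the relations apart, so each one can be counted alone. -/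
theorem count_neighborMultiset (G : MultiRelGraph r V) (u : V) {α : Type*} (f : V → α)
    [DecidableEq α] (i : Fin r) (c : α) [DecidablePred fun x => (G.rel i).Adj u x ∧ f x = c] :
    (G.neighborMultiset u fun i x => (f x, i)).count (c, i) =
      (Finset.univ.filter fun x => (G.rel i).Adj u x ∧ f x = c).card := by
  classical
  unfold neighborMultiset
  rw [Multiset.count_sum', Finset.sum_eq_single i]
  · rw [Multiset.count_map, ← Finset.filter_val, Finset.card_val, Finset.filter_filter]
    congr 1
    ext x
    simp [eq_comm]
  · intro j _ hj
    rw [Multiset.count_eq_zero]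
    simp [hj]
  · simp

/-- Stably equivalent tuples answer the moves of a component to the neighbors injectively. -/
theorem StablyEquiv.exists_injOn {G : MultiRelGraph r V} {H : MultiRelGraph r W} {v : Fin k → V}
    {w : Fin k → W} (h : StablyEquiv G H v w) (i : Fin r) (j : Fin k) :
    ∃ f : V → W, Set.InjOn f {x | (G.rel i).Adj (v j) x} ∧ ∀ x, (G.rel i).Adj (v j) x →
      (H.rel i).Adj (w j) (f x) ∧
        StablyEquiv G H (Function.update v j x) (Function.update w j (f x)) := by
  classical
  obtain ⟨T, hT⟩ := exists_stable_time k G H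
  -- Round `T + 1` records how many neighbors yield each color of round `T`. This matches the color
  -- classes one by one; the bijections are then glued.
  have key : ∀ c, ∃ g : V → W, Set.BijOn g
      {x | (G.rel i).Adj (v j) x ∧ G.rlwl T (Function.update v j x) = c}
      {y | (H.rel i).Adj (w j) y ∧ H.rlwl T (Function.update w j y) = c} := by
    intro c
    have : Nonempty W := ⟨w j⟩
    refine Set.Finite.exists_bijOn_of_encard_eq (Set.toFinite _) ?_
    have h2 := congrArg (Multiset.count (c, i))
      (congrFun (congrArg Prod.snd (h (T + 1))) j : G.neighborMultiset (v j) _ = _)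
    have h3 := (count_neighborMultiset G (v j)
      (fun x => G.rlwl T (Function.update v j x)) i c).symm.trans <| h2.trans <|
      count_neighborMultiset H (w j) (fun x => H.rlwl T (Function.update w j x)) i c
    rw [Set.encard_eq_coe_toFinset_card, Set.encard_eq_coe_toFinset_card]
    simpa using h3
  choose g hg using key
  refine ⟨fun x => g (G.rlwl T (Function.update v j x)) x, ?_, ?_⟩
  · intro x hx y hy hxy
    have h1 := (hg _).mapsTo ⟨hx, rfl⟩
    have h2 := (hg _).mapsTo ⟨hy, rfl⟩
    have h3 : G.rlwl T (Function.update v j x) = G.rlwl T (Function.update v j y) :=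
      h1.2.symm.trans ((congrArg (fun z => H.rlwl T (Function.update w j z)) hxy).trans h2.2)
    refine (hg _).injOn ⟨hx, rfl⟩ ⟨hy, h3.symm⟩ ?_
    simp only at hxy
    rw [hxy, h3]
  · intro x hx
    have h1 := (hg _).mapsTo ⟨hx, rfl⟩
    exact ⟨h1.1, hT _ _ h1.2.symm⟩

theorem StablyEquiv.exists_of_adj {G : MultiRelGraph r V} {H : MultiRelGraph r W}
    {v : Fin k → V} {w : Fin k → W} (h : StablyEquiv G H v w) (i : Fin r) (j : Fin k) {x : V}
    (hx : (G.rel i).Adj (v j) x) : ∃ y, (H.rel i).Adj (w j) y ∧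
      StablyEquiv G H (Function.update v j x) (Function.update w j y) := by
  obtain ⟨f, -, hf⟩ := h.exists_injOn i j
  exact ⟨f x, hf x hx⟩

end MultiRelGraph

/-! ### Twisting the construction -/

namespace CFI

open MultiRelGraph

variable {n : ℕ} {tw tw' : Finset (Fin n)}

theorem odd_card_symmDiff {α : Type*} [DecidableEq α] (s t : Finset α) :
    Odd (symmDiff s t).card ↔ ¬ (Odd s.card ↔ Odd t.card) := by
  have h1 : (symmDiff s t).card + 2 * (s ∩ t).card = s.card + t.card := by
    rw [symmDiff_eq_sup_sdiff_inf, Finset.sup_eq_union, Finset.inf_eq_inter,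
      Finset.card_sdiff_of_subset (Finset.inter_subset_left.trans Finset.subset_union_left)]
    have h2 := Finset.card_union_add_card_inter s t
    have h3 := Finset.card_le_card
      (Finset.inter_subset_left.trans Finset.subset_union_left : s ∩ t ⊆ s ∪ t)
    omega
  simp only [Nat.odd_iff]
  omega

theorem mem_incidenceSet_top {u : Fin n} {e : Sym2 (Fin n)} :
    e ∈ (⊤ : SimpleGraph (Fin n)).incidenceSet u ↔ ¬ e.IsDiag ∧ u ∈ e := by
  simp [SimpleGraph.incidenceSet]

/-- The base vertex of a vertex `(v, S)`. -/
def base : CFIVertex n tw → Option (Fin n)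
  | .inl p => some p.1.1
  | .inr _ => none

/-- The base edge of a vertex `e⁰` or `e¹`. -/
def edge : CFIVertex n tw → Option (Sym2 (Fin n))
  | .inl _ => none
  | .inr q => some q.1.1

/-- The set of edges at `u` that are flipped when the edges in `β` are flipped, up to a fault at
the vertex `a` and the edge `f`. -/
def flipSet (β : Finset (Sym2 (Fin n))) (a : Fin n) (f : Sym2 (Fin n)) (u : Fin n) :
    Finset (Sym2 (Fin n)) :=
  symmDiff (β.filter fun e => ¬ e.IsDiag ∧ u ∈ e) (if u = a then {f} else ∅)

/-- Flipping the edges in `β`, up to a fault at `a` and `f`, turns the twist `tw` into `tw'`. -/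
structure IsTwist (tw tw' β : Finset _) (a : Fin n) (f : Sym2 (Fin n)) : Prop where
  mem : ¬ f.IsDiag ∧ a ∈ f
  odd : ∀ u, Odd (flipSet β a f u).card ↔ ¬ (u ∈ tw ↔ u ∈ tw')

variable {β : Finset (Sym2 (Fin n))} {a : Fin n} {f : Sym2 (Fin n)}

theorem IsTwist.symm (h : IsTwist tw tw' β a f) : IsTwist tw' tw β a f :=
  ⟨h.mem, fun u => by rw [h.odd u, iff_comm (a := u ∈ tw)]⟩

theorem mem_flipSet {u : Fin n} {e : Sym2 (Fin n)} :
    e ∈ flipSet β a f u ↔ ¬ ((e ∈ β ∧ ¬ e.IsDiag ∧ u ∈ e) ↔ (u = a ∧ e = f)) := by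
  unfold flipSet
  split_ifs with h <;> simp [Finset.mem_symmDiff, h]
  all_goals tauto

/-- Only the parity of the flipped sets matters, and toggling any one edge at `a` has the same
effect on it. -/
theorem IsTwist.of_mem (h : IsTwist tw tw' β a f) {f' : Sym2 (Fin n)}
    (hf' : ¬ f'.IsDiag ∧ a ∈ f') : IsTwist tw tw' β a f' := by
  refine ⟨hf', fun u => ?_⟩
  rw [← h.odd u, flipSet, flipSet, odd_card_symmDiff, odd_card_symmDiff]
  split_ifs <;> simp

/-- At `a`, toggling `aa'` in `β` replaces the fault; at `a'`, the toggle and the new fault cancel.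
-/
theorem flipSet_move {a' : Fin n} (ha : a ≠ a') :
    flipSet (symmDiff β {s(a, a')}) a' s(a, a') = flipSet β a s(a, a') := by
  ext u e
  rw [mem_flipSet, mem_flipSet, Finset.mem_symmDiff, Finset.mem_singleton]
  by_cases he : e = s(a, a')
  · subst he
    have : ¬ (s(a, a')).IsDiag := ha
    by_cases h1 : u = a
    · subst h1
      simp [ha]
    · by_cases h2 : u = a'
      · subst h2
        simp [ha, ha.symm]
      · simp [h1, h2]
  · simp [he]

theorem IsTwist.move {a' : Fin n} (ha : a ≠ a') (h : IsTwist tw tw' β a s(a, a')) :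
    IsTwist tw tw' (symmDiff β {s(a, a')}) a' s(a, a') :=
  ⟨⟨ha, Sym2.mem_mk_right _ _⟩, fun u => by rw [flipSet_move ha, h.odd]⟩

/-- The map underlying `IsTwist.equiv`. -/
def IsTwist.map (h : IsTwist tw tw' β a f) : CFIVertex n tw → CFIVertex n tw'
  | .inl p => .inl ⟨(p.1.1, symmDiff p.1.2 (flipSet β a f p.1.1)), by
      refine ⟨fun e he => ?_, ?_⟩
      · rw [Finset.mem_symmDiff] at he
        rcases he with he | he
        · exact p.2.1 e he.1
        · rw [mem_incidenceSet_top]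
          have h1 := he.1
          rw [mem_flipSet] at h1
          by_contra hne
          refine h1 ⟨fun h2 => absurd h2.2 hne, fun h2 => ?_⟩
          rw [h2.1, h2.2] at hne
          exact absurd h.mem hne
      · have := p.2.2
        have h2 := h.odd p.1.1
        simp only [odd_card_symmDiff]
        tauto⟩
  | .inr q => .inr (q.1, xor q.2 (decide (q.1.1 ∈ β)))

theorem IsTwist.map_symm_map (h : IsTwist tw tw' β a f) (x : CFIVertex n tw) :
    h.symm.map (h.map x) = x := by
  rcases x with ⟨⟨u, S⟩, hS⟩ | ⟨e, b⟩
  · simp [IsTwist.map]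
  · simp [IsTwist.map]

/-- The bijection that flips the edges in `β`, up to a fault at `a` and `f`. -/
def IsTwist.equiv (h : IsTwist tw tw' β a f) : CFIVertex n tw ≃ CFIVertex n tw' where
  toFun := h.map
  invFun := h.symm.map
  left_inv := h.map_symm_map
  right_inv := h.symm.map_symm_map

theorem IsTwist.base_equiv (h : IsTwist tw tw' β a f) (x : CFIVertex n tw) :
    base (h.equiv x) = base x := by
  rcases x with p | q <;> rfl

/-- Away from the fault, the bit of the edge vertex and the membership of the edge in `S` flip
together. -/
theorem IsTwist.adj_inl_inr (h : IsTwist tw tw' β a f) (p) (q) (hpq : ¬ (p.1.1 = a ∧ q.1.1 = f)) :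
    (cfiGraph n tw).Adj (.inl p) (.inr q) ↔
      (cfiGraph n tw').Adj (h.equiv (.inl p)) (h.equiv (.inr q)) := by
  rcases q with ⟨⟨e, he⟩, b⟩
  rcases p with ⟨⟨u, S⟩, hS⟩
  simp only [IsTwist.equiv, IsTwist.map, Equiv.coe_fn_mk, cfiGraph, cfiAdj] at *
  refine and_congr_right fun hu => ?_
  have he' : ¬ e.IsDiag := by simpa using he
  rw [Finset.mem_symmDiff, mem_flipSet]
  have : ¬ (u = a ∧ e = f) := hpq
  cases b <;> by_cases h1 : e ∈ β <;> by_cases h2 : e ∈ S <;> simp [*]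

theorem IsTwist.adj_iff (h : IsTwist tw tw' β a f) {x y : CFIVertex n tw}
    (hxy : ¬ (base x = some a ∧ edge y = some f)) (hyx : ¬ (base y = some a ∧ edge x = some f)) :
    (cfiGraph n tw).Adj x y ↔ (cfiGraph n tw').Adj (h.equiv x) (h.equiv y) := by
  rcases x with p | q <;> rcases y with p' | q'
  · exact Iff.rfl
  · exact h.adj_inl_inr p q' (by simpa [base, edge] using hxy)
  · rw [SimpleGraph.adj_comm, h.adj_inl_inr p' q (by simpa [base, edge] using hyx),
      SimpleGraph.adj_comm]
  · rcases q with ⟨e, b⟩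
    rcases q' with ⟨e', b'⟩
    simp only [IsTwist.equiv, IsTwist.map, Equiv.coe_fn_mk, cfiGraph, cfiAdj]
    refine and_congr_right ?_
    rintro rfl
    simp

theorem IsTwist.equiv_eq_of_base_ne (h : IsTwist tw tw' β a f) {f' : Sym2 (Fin n)}
    (h' : IsTwist tw tw' β a f') {x : CFIVertex n tw} (hx : base x ≠ some a) :
    h.equiv x = h'.equiv x := by
  rcases x with ⟨⟨u, S⟩, hS⟩ | q
  · have hu : u ≠ a := by simpa [base] using hx
    simp [IsTwist.equiv, IsTwist.map, flipSet, hu]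
  · rfl

/-- Moving the fault along `aa'` affects only the two vertices of that edge, so it goes unnoticed by
tuples avoiding them. -/
theorem IsTwist.equiv_move {a' : Fin n} (ha : a ≠ a') (h : IsTwist tw tw' β a s(a, a'))
    {x : CFIVertex n tw} (hx : edge x ≠ some s(a, a')) :
    h.equiv x = (h.move ha).equiv x := by
  rcases x with p | ⟨e, b⟩
  · simp [IsTwist.equiv, IsTwist.map, flipSet_move ha]
  · have : e.1 ≠ s(a, a') := by simpa [edge] using hx
    simp [IsTwist.equiv, IsTwist.map, Finset.mem_symmDiff, this]

theorem exists_isTwist (hn : 2 ≤ n) [NeZero n] (a : Fin n) :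
    ∃ β f, IsTwist ∅ {0} β a f := by
  have : Nontrivial (Fin n) := Fin.nontrivial_iff_two_le.2 hn
  have h0 : ∀ c : Fin n, c ≠ 0 → IsTwist ∅ {0} ∅ 0 s(0, c) := fun c hc =>
    -- With no edge flipped, the fault alone changes the parity at `0`; it is then moved to the
    -- desired vertex.
    ⟨⟨hc.symm, Sym2.mem_mk_left _ _⟩, fun u => by
      rw [flipSet, odd_card_symmDiff]
      split_ifs with hu <;> simp [hu]⟩
  by_cases ha : a = 0
  · subst ha
    obtain ⟨c, hc⟩ := exists_ne (0 : Fin n)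
    exact ⟨_, _, h0 c hc⟩
  · exact ⟨_, _, (h0 a ha).move (Ne.symm ha)⟩

/-- The pairs of tuples that correspond under a twist with its fault at a base vertex that does
not occur in the tuples. -/
def TwistRel {k : ℕ} (v : Fin k → CFIVertex n tw) (w : Fin k → CFIVertex n tw') : Prop :=
  ∃ (β : Finset (Sym2 (Fin n))) (a : Fin n) (f : Sym2 (Fin n)) (h : IsTwist tw tw' β a f),
    (∀ i, base (v i) ≠ some a) ∧ w = h.equiv ∘ v

theorem TwistRel.atp_eq {k r : ℕ} {v : Fin k → CFIVertex n tw} {w : Fin k → CFIVertex n tw'}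
    (hvw : TwistRel v w) : (cfiMultiRel r n tw).atp v = (cfiMultiRel r n tw').atp w := by
  obtain ⟨β, a, f, h, hv, rfl⟩ := hvw
  refine Prod.ext ?_ ?_
  · funext p q
    simp [atp]
  · funext i p q
    exact propext (h.adj_iff (fun hp => hv p hp.1) fun hq => hv q hq.1)

/-- Each entry rules out at most one vertex: its base, or the other end of its edge if that contains
`a`. With `a` itself, at most `k + 1 < n` are excluded. -/
theorem exists_free_vertex {k : ℕ} (hk : k + 2 ≤ n) (v : Fin k → CFIVertex n tw) (a : Fin n) :
    ∃ a', a ≠ a' ∧ ∀ i, base (v i) ≠ some a' ∧ edge (v i) ≠ some s(a, a') := by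
  have h : ∀ i, ∃ z, ∀ x, (base (v i) = some x ∨ edge (v i) = some s(a, x)) → x = z := by
    intro i
    rcases v i with p | q
    · exact ⟨p.1.1, fun x hx => by simpa [base, edge, eq_comm] using hx⟩
    · by_cases hz : ∃ z, q.1.1 = s(a, z)
      · obtain ⟨z, hz⟩ := hz
        have hcongr : ∀ x, edge (tw := tw) (.inr q) = some s(a, x) → x = z := fun x hx =>
          (Sym2.congr_right.1 (hz.symm.trans (Option.some.inj hx))).symm
        exact ⟨z, fun x hx => hx.elim (fun hx => by simp [base] at hx) (hcongr x)⟩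
      -- This entry excludes nothing, so `a` is an arbitrary value.
      · refine ⟨a, fun x hx => absurd ?_ hz⟩
        exact ⟨x, by simpa [base, edge] using hx⟩
  choose z hz using h
  have hcard : (insert a (Finset.univ.image z)).card < (Finset.univ : Finset (Fin n)).card := by
    have h1 := Finset.card_insert_le a (Finset.univ.image z)
    have h2 := Finset.card_image_le (s := Finset.univ) (f := z)
    simp only [Finset.card_univ, Fintype.card_fin] at h2 ⊢
    omega
  obtain ⟨a', -, ha'⟩ := Finset.exists_mem_notMem_of_card_lt_card hcard
  simp only [Finset.mem_insert, Finset.mem_image, Finset.mem_univ, true_and, not_or,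
    not_exists] at ha'
  exact ⟨a', fun h => ha'.1 h.symm, fun i => ⟨fun h => ha'.2 i (hz i a' (Or.inl h)).symm,
    fun h => ha'.2 i (hz i a' (Or.inr h)).symm⟩⟩

theorem TwistRel.step {k : ℕ} (hk : k + 2 ≤ n) {v : Fin k → CFIVertex n tw}
    {w : Fin k → CFIVertex n tw'} (hvw : TwistRel v w) (j : Fin k) :
    ∃ e : CFIVertex n tw ≃ CFIVertex n tw', ∀ x,
      ((cfiGraph n tw).Adj (v j) x ↔ (cfiGraph n tw').Adj (w j) (e x)) ∧
        TwistRel (Function.update v j x) (Function.update w j (e x)) := by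
  obtain ⟨β, a, f, h, hv, rfl⟩ := hvw
  obtain ⟨a', ha, hfree⟩ := exists_free_vertex hk v a
  have h' : IsTwist tw tw' β a s(a, a') := h.of_mem ⟨ha, Sym2.mem_mk_left _ _⟩
  have heq : h.equiv ∘ v = h'.equiv ∘ v := funext fun i => h.equiv_eq_of_base_ne h' (hv i)
  rw [heq]
  refine ⟨h'.equiv, fun x => ⟨h'.adj_iff (fun hp => hv j hp.1) fun hq => (hfree j).2 hq.2, ?_⟩⟩
  rw [← Function.comp_update]
  -- The fault has to move exactly when the new entry lies over `a`.
  by_cases hx : base x = some a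
  · refine ⟨_, a', _, h'.move ha, fun i => ?_, funext fun i => h'.equiv_move ha ?_⟩
    · rcases eq_or_ne i j with rfl | hij
      · simpa [hx] using ha
      · simpa [hij] using (hfree i).1
    · rcases eq_or_ne i j with rfl | hij
      · rcases x with p | q
        · simp [edge]
        · simp [base] at hx
      · simpa [hij] using (hfree i).2
  · refine ⟨_, a, _, h', fun i => ?_, rfl⟩
    rcases eq_or_ne i j with rfl | hij
    · simpa using hx
    · simpa [hij] using hv i

theorem not_rlwlDistinguishes {k r : ℕ} [NeZero n] (hk : k + 2 ≤ n) :
    ¬ RLWLDistinguishes k (cfiMultiRel r n ∅) (cfiMultiRel r n {0}) := by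
  have havoid : ∀ b : Fin k → Option (Fin n), ∃ a, ∀ i, b i ≠ some a := by
    intro b
    have hcard : (Finset.univ.image b).card < (Finset.univ.image (some : Fin n → _)).card := by
      rw [Finset.card_image_of_injective _ (Option.some_injective _)]
      have h2 := Finset.card_image_le (s := Finset.univ) (f := b)
      simp only [Finset.card_univ, Fintype.card_fin] at h2 ⊢
      omega
    obtain ⟨a', h1, ha'⟩ := Finset.exists_mem_notMem_of_card_lt_card hcard
    obtain ⟨a, -, rfl⟩ := Finset.mem_image.1 h1
    exact ⟨a, fun i hi => ha' (Finset.mem_image.2 ⟨i, Finset.mem_univ _, hi⟩)⟩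
  choose A hA using havoid
  choose β f h using exists_isTwist (n := n) (by omega)
  -- The twist applied to a tuple depends only on its bases. Twists preserve bases, so the inverse
  -- can recover which twist was used.
  let e : (Fin k → CFIVertex n ∅) ≃ (Fin k → CFIVertex n {0}) :=
    { toFun := fun v => (h (A (base ∘ v))).equiv ∘ v
      invFun := fun w => (h (A (base ∘ w))).equiv.symm ∘ w
      left_inv := fun v => by
        have : base ∘ (h (A (base ∘ v))).equiv ∘ v = base ∘ v :=
          funext fun i => IsTwist.base_equiv _ _
        simp only [this]
        funext i
        simp
      right_inv := fun w => by
        have : base ∘ (h (A (base ∘ w))).equiv.symm ∘ w = base ∘ w :=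
          funext fun i => IsTwist.base_equiv (h (A (base ∘ w))).symm _
        simp only [this]
        funext i
        simp }
  refine not_rlwlDistinguishes_of_equiv e fun t v => ?_
  refine rlwl_eq_of_bisim TwistRel (fun _ _ hvw => hvw.atp_eq) (fun v w hvw j => ?_) t v _
    ⟨_, _, _, h (A (base ∘ v)), fun i => hA (base ∘ v) i, rfl⟩
  obtain ⟨e, he⟩ := hvw.step hk j
  exact ⟨e, fun i x => ⟨(he x).1, fun _ => (he x).2⟩⟩

end CFI

/-! ### Covered pairs -/

/-- Every neighbor of `x` is adjacent to `p` or has a common neighbor with `p`. -/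
def SimpleGraph.Covered {V : Type*} (A : SimpleGraph V) (x p : V) : Prop :=
  ∀ w, A.Adj x w → A.Adj w p ∨ ∃ w', A.Adj w w' ∧ A.Adj w' p

theorem MultiRelGraph.StablyEquiv.covered {k r : ℕ} {V W : Type*} [Fintype V] [Fintype W]
    {G : MultiRelGraph r V} {H : MultiRelGraph r W} {v : Fin k → V} {w : Fin k → W}
    (h : StablyEquiv G H v w) (l : Fin r) {i j : Fin k} (hij : i ≠ j)
    (hv : (G.rel l).Covered (v i) (v j)) : (H.rel l).Covered (w i) (w j) := by
  intro y hy
  obtain ⟨z, hz, hzy⟩ := h.symm.exists_of_adj l i hy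
  rcases hv z hz with h1 | ⟨z', h1, h2⟩
  · left
    simpa [hij.symm] using (hzy.symm.adj_iff l i j).1 (by simpa [hij.symm] using h1)
  · right
    obtain ⟨y', hy', hzy'⟩ := hzy.symm.exists_of_adj l i (x := z') (by simpa using h1)
    refine ⟨y', by simpa using hy', ?_⟩
    simpa [hij.symm] using (hzy'.adj_iff l i j).1 (by simpa [hij.symm] using h2)

/-! ### Recognizing gadget vertices and linked pairs. -/

namespace CFI

open MultiRelGraph

variable {n : ℕ} {tw tw' : Finset (Fin n)}

/-- The vertices of the form `(v, S)`. -/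
abbrev Gadget (n : ℕ) (tw : Finset (Fin n)) : Type :=
  {p : Fin n × Finset (Sym2 (Fin n)) //
    (∀ e ∈ p.2, e ∈ (⊤ : SimpleGraph (Fin n)).incidenceSet p.1) ∧ (Odd p.2.card ↔ p.1 ∈ tw)}

/-- The edge `uc` is left unprescribed to correct the parity. -/
theorem exists_gadget (tw : Finset (Fin n)) (u c : Fin n) (huc : u ≠ c)
    (P : Sym2 (Fin n) → Prop) :
    ∃ p : Gadget n tw, p.1.1 = u ∧ ∀ x, x ≠ u → x ≠ c → (s(u, x) ∈ p.1.2 ↔ P s(u, x)) := by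
  classical
  let T : Finset (Sym2 (Fin n)) := Finset.univ.filter fun e => (¬ e.IsDiag ∧ u ∈ e) ∧ P e
  have hT : ∀ x, x ≠ u → (s(u, x) ∈ T ↔ P s(u, x)) := fun x hx => by simp [T, hx.symm]
  by_cases h : Odd T.card ↔ u ∈ tw
  · refine ⟨⟨(u, T), fun e he => ?_, h⟩, rfl, fun x hx _ => hT x hx⟩
    rw [mem_incidenceSet_top]
    exact (Finset.mem_filter.1 he).2.1
  · refine ⟨⟨(u, symmDiff T {s(u, c)}), fun e he => ?_, ?_⟩, rfl, fun x hx hxc => ?_⟩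
    · rw [mem_incidenceSet_top]
      rcases Finset.mem_symmDiff.1 he with he | he
      · exact (Finset.mem_filter.1 he.1).2.1
      · rw [Finset.mem_singleton.1 he.1]
        exact ⟨huc, Sym2.mem_mk_left _ _⟩
    · simp only [odd_card_symmDiff, Finset.card_singleton, odd_one, iff_true]
      tauto
    · rw [← hT x hx]
      have : s(u, x) ≠ s(u, c) := fun h => hxc (Sym2.congr_right.1 h)
      simp [Finset.mem_symmDiff, this]

theorem exists_ne_three (hn : 4 ≤ n) (x y z : Fin n) : ∃ c, c ≠ x ∧ c ≠ y ∧ c ≠ z := by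
  have hcard : ({x, y, z} : Finset (Fin n)).card < (Finset.univ : Finset (Fin n)).card := by
    have := Finset.card_le_three (a := x) (b := y) (c := z)
    simp only [Finset.card_univ, Fintype.card_fin]
    omega
  obtain ⟨c, -, hc⟩ := Finset.exists_mem_notMem_of_card_lt_card hcard
  exact ⟨c, by simpa using hc⟩

theorem Gadget.not_isDiag (p : Gadget n tw) {e : Sym2 (Fin n)} (he : e ∈ p.1.2) :
    ¬ e.IsDiag ∧ p.1.1 ∈ e :=
  mem_incidenceSet_top.1 (p.2.1 e he)

theorem eq_of_mem {e : Sym2 (Fin n)} {u x : Fin n} (hne : u ≠ x) (hu : u ∈ e) (hx : x ∈ e) :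
    e = s(u, x) :=
  (Sym2.mem_and_mem_iff hne).1 ⟨hu, hx⟩

theorem not_isDiag_edge (e : (⊤ : SimpleGraph (Fin n)).edgeSet) : ¬ e.1.IsDiag := by
  simpa using e.2

theorem exists_mem_ne {e : Sym2 (Fin n)} (he : ¬ e.IsDiag) (u : Fin n) : ∃ c ∈ e, c ≠ u := by
  induction e using Sym2.ind with
  | _ x y =>
  by_cases hx : x = u
  · exact ⟨y, Sym2.mem_mk_right _ _, fun hy => he (hx.trans hy.symm)⟩
  · exact ⟨x, Sym2.mem_mk_left _ _, hx⟩

theorem exists_adj_edge (p : Gadget n tw) (e : (⊤ : SimpleGraph (Fin n)).edgeSet)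
    (he : p.1.1 ∈ e.1) : ∃ b, (cfiGraph n tw).Adj (.inl p) (.inr (e, b)) :=
  ⟨decide (e.1 ∈ p.1.2), he, by simp⟩

/-- Over a shared base, `q` sees one of `e⁰`, `e¹` for each edge `e` there, and these two are
adjacent. -/
theorem covered_of_base_eq {p q : Gadget n tw} (h : p.1.1 = q.1.1) :
    (cfiGraph n tw).Covered (.inl p) (.inl q) := by
  rintro (p' | ⟨e, b⟩) hw
  · exact hw.elim
  · have hq : q.1.1 ∈ e.1 := h ▸ hw.1
    by_cases hb : b = true ↔ e.1 ∈ q.1.2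
    · exact Or.inl ⟨hq, hb⟩
    · refine Or.inr ⟨.inr (e, !b), ⟨rfl, by simp⟩, hq, ?_⟩
      cases b <;> simp_all

theorem not_covered_of_base_ne (hn : 4 ≤ n) {p q : Gadget n tw} (h : p.1.1 ≠ q.1.1) :
    ¬ (cfiGraph n tw).Covered (.inl p) (.inl q) := by
  intro hcov
  obtain ⟨c, hcp, hcq, -⟩ := exists_ne_three hn p.1.1 q.1.1 q.1.1
  have hq : q.1.1 ∉ s(p.1.1, c) := by simp [h.symm, hcq.symm]
  obtain ⟨b, hb⟩ := exists_adj_edge p ⟨s(p.1.1, c), hcp.symm⟩ (Sym2.mem_mk_left _ _)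
  rcases hcov _ hb with h1 | ⟨p' | ⟨e, b'⟩, h1, h2⟩
  · exact hq h1.1
  · exact h2
  · have h3 := h2.1
    rw [← h1.1] at h3
    exact hq h3

/-- With the two lemmas above, this makes being covered a test for gadget vertices over the same
base. The uncovered neighbor is a gadget vertex at an end of the edge, chosen to have no common
neighbor with `y`. -/
theorem not_covered_of_edge (hn : 4 ≤ n) (q) {y : CFIVertex n tw} (hne : .inr q ≠ y)
    (hadj : ¬ (cfiGraph n tw).Adj (.inr q) y) : ¬ (cfiGraph n tw).Covered (.inr q) y := by
  intro hcov
  obtain ⟨e, b⟩ := q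
  have he := not_isDiag_edge e
  rcases y with t | ⟨f, b'⟩
  · obtain ⟨c, hc, hct⟩ := exists_mem_ne he t.1.1
    obtain ⟨d, hd⟩ := hc
    rw [hd] at he
    have hcd : c ≠ d := he
    obtain ⟨g, hgc, hgd, hgt⟩ := exists_ne_three hn c d t.1.1
    -- This vertex is adjacent to `(e, b)` and disagrees with `t` on the edge between their bases;
    -- if that edge is `e`, the disagreement comes from `hadj`. The spare vertex `g` fixes the
    -- parity.
    obtain ⟨p, rfl, hp⟩ := exists_gadget tw c g hgc.symm
      fun e' => (e' = e.1 ∧ b = true) ∨ (e' ≠ e.1 ∧ e' ∉ t.1.2)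
    have h1 : b = true ↔ e.1 ∈ p.1.2 := by
      rw [hd, hp d hcd.symm hgd.symm]
      simp [hd]
    have h2 : s(p.1.1, t.1.1) ∈ p.1.2 ↔ s(p.1.1, t.1.1) ∉ t.1.2 := by
      by_cases heq : s(p.1.1, t.1.1) = e.1
      · rw [heq, ← h1]
        have : ¬ (b = true ↔ e.1 ∈ t.1.2) := fun h => hadj ⟨heq ▸ Sym2.mem_mk_right _ _, h⟩
        tauto
      · rw [hp _ hct.symm hgt.symm]
        simp [heq]
    rcases hcov (.inl p) ⟨hd ▸ Sym2.mem_mk_left _ _, h1⟩ with h3 | ⟨p' | ⟨f, b'⟩, h3, h4⟩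
    · exact h3
    · exact h3
    · have h5 := h3.2
      have h6 := h4.2
      rw [eq_of_mem hct h3.1 h4.1] at h5 h6
      tauto
  · have hef : e.1 ≠ f.1 := by
      intro h
      have h' : e = f := Subtype.ext h
      subst h'
      by_cases hb : b = b'
      · exact hne (by rw [hb])
      · exact hadj ⟨rfl, hb⟩
    obtain ⟨c, hc, hcf⟩ : ∃ c ∈ e.1, c ∉ f.1 := by
      by_contra hall
      push Not at hall
      have hc := Sym2.out_fst_mem e.1
      obtain ⟨d, hd, hdc⟩ := exists_mem_ne he (Quot.out e.1).1
      exact hef ((eq_of_mem hdc hd hc).trans (eq_of_mem hdc (hall d hd) (hall _ hc)).symm)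
    obtain ⟨d, hd⟩ := hc
    rw [hd] at he
    have hcd : c ≠ d := he
    obtain ⟨g, hgc, hgd, -⟩ := exists_ne_three hn c d d
    obtain ⟨p, rfl, hp⟩ := exists_gadget tw c g hgc.symm fun _ => b = true
    have h1 : b = true ↔ e.1 ∈ p.1.2 := by
      rw [hd, hp d hcd.symm hgd.symm]
    rcases hcov (.inl p) ⟨hd ▸ Sym2.mem_mk_left _ _, h1⟩ with h3 | ⟨p' | ⟨f', b'⟩, h3, h4⟩
    · exact hcf h3.1
    · exact h3
    · exact hcf (h4.1 ▸ h3.1)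

/-- The vertices are `(u, S)` and `(u', S')` with `u ≠ u'`, where `S` and `S'` agree on the edge
between `u` and `u'`. -/
def Linked (x y : CFIVertex n tw) : Prop :=
  ∃ p q : Gadget n tw, x = .inl p ∧ y = .inl q ∧ p.1.1 ≠ q.1.1 ∧
    (s(p.1.1, q.1.1) ∈ p.1.2 ↔ s(p.1.1, q.1.1) ∈ q.1.2)

theorem Linked.symm {x y : CFIVertex n tw} (h : Linked x y) : Linked y x := by
  obtain ⟨p, q, hx, hy, hne, hpq⟩ := h
  exact ⟨q, p, hy, hx, hne.symm, by rw [Sym2.eq_swap, hpq]⟩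

theorem Linked.of_adj {p q : Gadget n tw} {z : CFIVertex n tw} (hne : p.1.1 ≠ q.1.1)
    (h1 : (cfiGraph n tw).Adj (.inl p) z) (h2 : (cfiGraph n tw).Adj (.inl q) z) :
    Linked (.inl p : CFIVertex n tw) (.inl q) := by
  rcases z with _ | ⟨e, b⟩
  · exact h1.elim
  · refine ⟨p, q, rfl, rfl, hne, ?_⟩
    rw [← eq_of_mem hne h1.1 h2.1, ← h1.2, ← h2.2]

theorem Linked.exists_adj {x y : CFIVertex n tw} (h : Linked x y) :
    ∃ z, (cfiGraph n tw).Adj x z ∧ (cfiGraph n tw).Adj z y := by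
  obtain ⟨p, q, rfl, rfl, hne, hpq⟩ := h
  exact ⟨.inr (⟨s(p.1.1, q.1.1), hne⟩, decide (s(p.1.1, q.1.1) ∈ p.1.2)),
    ⟨Sym2.mem_mk_left _ _, by simp⟩, Sym2.mem_mk_right _ _, by simp [hpq]⟩

section Stable

variable {k r : ℕ} {v : Fin k → CFIVertex n tw} {w : Fin k → CFIVertex n tw'} {i j : Fin k}

/-- Component `j` is walked through the common neighbor to another vertex over the base of `v i`.
The resulting pair is covered, distinct and nonadjacent, which an edge vertex at `w i` could not
match. -/
theorem exists_gadget_of_stablyEquiv (hn : 4 ≤ n) (l : Fin r)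
    (h : StablyEquiv (cfiMultiRel r n tw) (cfiMultiRel r n tw') v w) (hij : i ≠ j)
    (hv : Linked (v i) (v j)) : ∃ p, w i = .inl p := by
  obtain ⟨p, q, hp, hq, hne, hpq⟩ := hv
  obtain ⟨c, hcp, hcq, -⟩ := exists_ne_three hn p.1.1 q.1.1 q.1.1
  obtain ⟨d, hdp, hdq, hdc⟩ := exists_ne_three hn p.1.1 q.1.1 c
  -- Agreement on the edge to `q` keeps the common neighbor, the edge to `c` ensures `p₂ ≠ p`, and
  -- the edge to `d` absorbs the parity.
  obtain ⟨p₂, hp₂, hmem⟩ := exists_gadget tw p.1.1 d hdp.symm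
    fun e => if e = s(p.1.1, q.1.1) then e ∈ p.1.2 else e ∉ p.1.2
  have hpp₂ : p ≠ p₂ := by
    rintro rfl
    have h1 := hmem c hcp hdc.symm
    rw [if_neg fun h => hcq (Sym2.congr_right.1 h)] at h1
    tauto
  have hq₂ := hmem q.1.1 hne.symm hdq.symm
  rw [if_pos rfl] at hq₂
  let z : CFIVertex n tw :=
    .inr (⟨s(p.1.1, q.1.1), hne⟩, decide (s(p.1.1, q.1.1) ∈ p.1.2))
  have hz : (cfiGraph n tw).Adj (.inl q) z := ⟨Sym2.mem_mk_right _ _, by simp [hpq]⟩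
  have hz₂ : (cfiGraph n tw).Adj z (.inl p₂) :=
    ⟨show p₂.1.1 ∈ s(p.1.1, q.1.1) by rw [hp₂]; exact Sym2.mem_mk_left _ _, by simp [hq₂]⟩
  obtain ⟨y₁, -, h₁⟩ := h.exists_of_adj l j (x := z) (by rw [hq]; exact hz)
  obtain ⟨y₂, -, h₂⟩ := h₁.exists_of_adj l j (x := .inl p₂) (by
    rw [Function.update_self]; exact hz₂)
  rw [Function.update_idem, Function.update_idem] at h₂
  have hcov := h₂.covered l hij (by
    rw [Function.update_self, Function.update_of_ne hij, hp]
    exact covered_of_base_eq hp₂.symm)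
  have hneq := mt (h₂.eq_iff i j).2 (by
    rw [Function.update_self, Function.update_of_ne hij, hp]
    exact fun h => hpp₂ (Sum.inl.inj h))
  have hnadj := mt (h₂.adj_iff l i j).2 (by
    rw [Function.update_self, Function.update_of_ne hij, hp]
    exact id)
  rw [Function.update_self, Function.update_of_ne hij] at hcov hneq hnadj
  rcases hw : w i with p' | q'
  · exact ⟨p', rfl⟩
  · rw [hw] at hcov hneq hnadj
    exact absurd hcov (not_covered_of_edge hn q' hneq hnadj)

theorem linked_of_stablyEquiv (hn : 4 ≤ n) (l : Fin r)
    (h : StablyEquiv (cfiMultiRel r n tw) (cfiMultiRel r n tw') v w) (hij : i ≠ j)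
    (hv : Linked (v i) (v j)) : Linked (w i) (w j) := by
  obtain ⟨p', hp'⟩ := exists_gadget_of_stablyEquiv hn l h hij hv
  obtain ⟨q', hq'⟩ := exists_gadget_of_stablyEquiv hn l h hij.symm hv.symm
  obtain ⟨z, hz₁, hz₂⟩ := hv.exists_adj
  obtain ⟨y, hy, hzy⟩ := h.exists_of_adj l i hz₁
  have hy₂ := (hzy.adj_iff l i j).1 (by
    rw [Function.update_self, Function.update_of_ne hij.symm]; exact hz₂)
  rw [Function.update_self, Function.update_of_ne hij.symm, hq'] at hy₂
  rw [hp'] at hy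
  rw [hp', hq']
  refine Linked.of_adj (fun heq => ?_) hy hy₂.symm
  obtain ⟨p, q, hp, hq, hne, -⟩ := hv
  have hcov := h.symm.covered l hij (by rw [hp', hq']; exact covered_of_base_eq heq)
  rw [hp, hq] at hcov
  exact not_covered_of_base_ne hn hne hcov

end Stable

/-- A family of pairwise linked vertices over all base vertices exists only if the number of
twists is even. -/
theorem even_card_of_linked (hn : 2 ≤ n) (y : Fin n → CFIVertex n tw)
    (hy : ∀ i j, i ≠ j → Linked (y i) (y j)) : Even tw.card := by
  classical
  have : Nontrivial (Fin n) := Fin.nontrivial_iff_two_le.2 hn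
  have hp : ∀ i, ∃ p : Gadget n tw, y i = .inl p := by
    intro i
    obtain ⟨j, hj⟩ := exists_ne i
    obtain ⟨p, -, hp, -⟩ := hy i j hj.symm
    exact ⟨p, hp⟩
  choose p hp using hp
  have hlink : ∀ i j, i ≠ j → (p i).1.1 ≠ (p j).1.1 ∧
      (s((p i).1.1, (p j).1.1) ∈ (p i).1.2 ↔ s((p i).1.1, (p j).1.1) ∈ (p j).1.2) := by
    intro i j hij
    obtain ⟨a, b, ha, hb, h⟩ := hy i j hij
    rw [hp, Sum.inl.injEq] at ha hb
    subst ha hb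
    exact h
  have hinj : Function.Injective fun i => (p i).1.1 := fun i j h =>
    by_contra fun hij => (hlink i j hij).1 h
  let σ := Equiv.ofBijective _ (Finite.injective_iff_bijective.1 hinj)
  have hσ : ∀ i, σ i = (p i).1.1 := fun _ => rfl
  -- An edge belongs to the sets at both of its ends or to neither. Summing over all edges makes the
  -- total size of the sets even, hence also the number of odd sets.
  have hcard : ∀ e : Sym2 (Fin n), Even (Finset.univ.filter fun i => e ∈ (p i).1.2).card := by
    intro e
    induction e using Sym2.ind with
    | _ a b =>
    obtain ⟨i, rfl⟩ := σ.surjective a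
    obtain ⟨j, rfl⟩ := σ.surjective b
    rcases eq_or_ne i j with rfl | hij
    · rw [Finset.filter_eq_empty_iff.2 fun l _ hl => ((p l).not_isDiag hl).1 (Sym2.mk_isDiag_iff.2 rfl)]
      simp
    · have hsub : ∀ l, s(σ i, σ j) ∈ (p l).1.2 → l = i ∨ l = j := fun l hl => by
        have h1 := ((p l).not_isDiag hl).2
        rw [← hσ, Sym2.mem_iff] at h1
        simpa using h1
      by_cases h : s(σ i, σ j) ∈ (p i).1.2
      · have : (Finset.univ.filter fun l => s(σ i, σ j) ∈ (p l).1.2) = {i, j} := by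
          ext l
          simp only [Finset.mem_filter, Finset.mem_univ, true_and, Finset.mem_insert,
            Finset.mem_singleton]
          refine ⟨hsub l, ?_⟩
          rintro (rfl | rfl)
          · exact h
          · exact (hlink i l hij).2.1 h
        rw [this, Finset.card_pair hij]
        exact even_two
      · rw [Finset.filter_eq_empty_iff.2 fun l _ hl => ?_]
        · simp
        · rcases hsub l hl with rfl | rfl
          · exact h hl
          · exact h ((hlink i l hij).2.2 hl)
  have hsum : ∑ i, (p i).1.2.card =
      ∑ e, (Finset.univ.filter fun i => e ∈ (p i).1.2).card := by
    simp_rw [Finset.card_filter]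
    rw [Finset.sum_comm]
    simp
  have hodd : (Finset.univ.filter fun i => Odd (p i).1.2.card).card = tw.card := by
    refine Finset.card_bij (fun i _ => σ i) ?_ (fun _ _ _ _ h => σ.injective h) ?_
    · intro i hi
      exact (p i).2.2.1 (Finset.mem_filter.1 hi).2
    · intro u hu
      obtain ⟨i, rfl⟩ := σ.surjective u
      exact ⟨i, Finset.mem_filter.2 ⟨Finset.mem_univ _, (p i).2.2.2 hu⟩, rfl⟩
  rw [← Nat.not_odd_iff_even, ← hodd, ← Finset.odd_sum_iff_odd_card_odd, hsum,
    Nat.not_odd_iff_even]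
  exact Finset.even_sum _ fun e _ => hcard e

end CFI

/-! ### The `(k + 1)`-RLWL detects the twist. -/

namespace CFI

open MultiRelGraph

variable {n : ℕ}

/-- The vertex `(u, ∅)`. -/
def origin (u : Fin n) : CFIVertex n ∅ :=
  .inl ⟨(u, ∅), by simp, by simp⟩

theorem linked_origin {u u' : Fin n} (h : u ≠ u') : Linked (origin u) (origin u') :=
  ⟨_, _, rfl, rfl, h, by simp⟩

/-- Gadget vertices of the same base vertex that have a common neighbor, not adjacent to the
vertices of a family over all but one of the other base vertices, are equal if they are linked to
all members of the family. -/
theorem eq_of_linked_of_base_eq {k : ℕ} {tw : Finset (Fin (k + 2))} {p q : Gadget (k + 2) tw}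
    {z : CFIVertex (k + 2) tw} (hbase : p.1.1 = q.1.1)
    (hp : (cfiGraph (k + 2) tw).Adj (.inl p) z) (hq : (cfiGraph (k + 2) tw).Adj (.inl q) z)
    (y : Fin k → CFIVertex (k + 2) tw) (hy : ∀ i j, i ≠ j → Linked (y i) (y j))
    (hyz : ∀ i, ¬ (cfiGraph (k + 2) tw).Adj z (y i))
    (hpy : ∀ i, Linked (.inl p) (y i)) (hqy : ∀ i, Linked (.inl q) (y i)) : p = q := by
  classical
  rcases z with _ | ⟨e, b⟩
  · exact hp.elim
  have hm : ∀ i, ∃ m : Gadget (k + 2) tw, y i = .inl m := fun i => by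
    obtain ⟨_, m, -, hm, -⟩ := hpy i
    exact ⟨m, hm⟩
  choose m hm using hm
  have hlink : ∀ (p' : Gadget (k + 2) tw) i, Linked (.inl p') (y i) → p'.1.1 ≠ (m i).1.1 ∧
      (s(p'.1.1, (m i).1.1) ∈ p'.1.2 ↔ s(p'.1.1, (m i).1.1) ∈ (m i).1.2) := by
    rintro p' i ⟨a, c, ha, hc, h⟩
    rw [hm, Sum.inl.injEq] at hc
    rw [Sum.inl.injEq] at ha
    subst ha hc
    exact h
  obtain ⟨d, hd⟩ := hp.1
  have hpd : p.1.1 ≠ d := fun h => not_isDiag_edge e (hd ▸ h)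
  have hinj : Function.Injective fun i => (m i).1.1 := fun i j h => by
    by_contra hij
    exact (hlink (m i) j (by rw [← hm]; exact hy i j hij)).1 h
  -- If the other end `d` of the edge of `z` were the base of `y i`, the link from `p` to `y i`
  -- would make `z` adjacent to `y i`.
  have hdm : ∀ i, d ≠ (m i).1.1 := by
    rintro i rfl
    refine hyz i ?_
    rw [hm]
    refine ⟨hd ▸ Sym2.mem_mk_right _ _, ?_⟩
    rw [hp.2, hd]
    exact (hlink p i (hpy i)).2
  have hall : ∀ x, x = p.1.1 ∨ x = d ∨ ∃ i, x = (m i).1.1 := by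
    have hcard : (insert p.1.1 (insert d (Finset.univ.image fun i => (m i).1.1))).card =
        (Finset.univ : Finset (Fin (k + 2))).card := by
      rw [Finset.card_insert_of_notMem, Finset.card_insert_of_notMem,
        Finset.card_image_of_injective _ hinj]
      · simp
      · simpa using fun i h => hdm i h.symm
      · simpa [hpd] using fun i h => (hlink p i (hpy i)).1 h.symm
    have huniv := Finset.eq_univ_of_card _ hcard
    intro x
    have := Finset.mem_univ x
    rw [← huniv] at this
    simpa [eq_comm] using this
  refine Subtype.ext (Prod.ext hbase (Finset.ext fun f => ?_))
  by_cases hf : ¬ f.IsDiag ∧ p.1.1 ∈ f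
  · obtain ⟨hf, x, rfl⟩ := hf
    -- Membership of the edge to `d` is fixed by the common neighbor `z`, that of all other edges by
    -- the links to the family.
    rcases hall x with rfl | rfl | ⟨i, rfl⟩
    · exact absurd rfl hf
    · rw [← hd, ← hp.2, ← hq.2]
    · rw [(hlink p i (hpy i)).2, hbase, (hlink q i (hqy i)).2]
  · exact iff_of_false (fun h => hf (p.not_isDiag h)) fun h => hf (hbase ▸ q.not_isDiag h)

theorem rlwlDistinguishes {k r : ℕ} (hk : 2 ≤ k) (hr : 1 ≤ r) :
    RLWLDistinguishes (k + 1) (cfiMultiRel r (k + 2) ∅) (cfiMultiRel r (k + 2) {0}) := by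
  by_contra hnot
  have hn : 4 ≤ k + 2 := by omega
  let l : Fin r := ⟨0, hr⟩
  -- The bit is `false` because the sets of `origin 0` and `origin 1` are empty, so `z` is their
  -- common neighbor. The other `k` entries occupy the base vertices from `2` on.
  let z : CFIVertex (k + 2) ∅ := .inr (⟨s(0, 1), by simp⟩, false)
  let v : Fin (k + 1) → CFIVertex (k + 2) ∅ := Fin.cons z fun i => origin i.succ.succ
  obtain ⟨w, hw⟩ := exists_stablyEquiv hnot v
  obtain ⟨f, hinj, hf⟩ := hw.exists_injOn l 0
  have hz : ∀ c : Fin (k + 2), c = 0 ∨ c = 1 → (cfiGraph (k + 2) ∅).Adj z (origin c) := by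
    intro c hc
    exact ⟨Sym2.mem_iff.2 hc, by simp⟩
  have hlink : ∀ c : Fin (k + 2), c = 0 ∨ c = 1 →
      (∀ i : Fin k, Linked (f (origin c)) (w i.succ)) ∧
        ∀ i j : Fin k, i ≠ j → Linked (w i.succ) (w j.succ) := by
    intro c hc
    have h := (hf _ (hz c hc)).2
    have hv : ∀ i : Fin k, Function.update v 0 (origin c) i.succ = origin i.succ.succ := fun i =>
      by simp [v]
    have hwi : ∀ i : Fin k, Function.update w 0 (f (origin c)) i.succ = w i.succ := fun i => by
      simp
    constructor
    · intro i
      have := linked_of_stablyEquiv hn l h (Fin.succ_ne_zero i).symm (by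
        rw [hv, Function.update_self]
        refine linked_origin ?_
        rintro rfl
        rcases hc with hc | hc
        · exact Fin.succ_ne_zero _ hc
        · exact Fin.succ_ne_zero _ (Fin.succ_injective _ hc))
      rwa [hwi, Function.update_self] at this
    · intro i j hij
      have := linked_of_stablyEquiv hn l h ((Fin.succ_injective _).ne hij) (by
        rw [hv, hv]
        exact linked_origin fun h => hij (Fin.succ_injective _ (Fin.succ_injective _ h)))
      rwa [hwi, hwi] at this
  have h0 := hlink 0 (Or.inl rfl)
  have h1 := hlink 1 (Or.inr rfl)
  have hadj0 := (hf _ (hz 0 (Or.inl rfl))).1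
  have hadj1 := (hf _ (hz 1 (Or.inr rfl))).1
  have hne : f (origin 0) ≠ f (origin 1) := fun h => by
    have := hinj (hz 0 (Or.inl rfl)) (hz 1 (Or.inr rfl)) h
    simp [origin] at this
  have hnadj : ∀ i : Fin k, ¬ (cfiGraph (k + 2) {0}).Adj (w 0) (w i.succ) := by
    intro i h
    have := ((hw.adj_iff l 0 i.succ).2 h).1
    rcases Sym2.mem_iff.1 this with h | h
    · exact Fin.succ_ne_zero i.succ h
    · exact Fin.succ_ne_zero i (Fin.succ_injective _ h)
  -- The two answers share the neighbor `w 0`, so they are linked unless their bases coincide. In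
  -- that case they would be equal, contradicting injectivity of the answers.
  have h01 : Linked (f (origin 0)) (f (origin 1)) := by
    obtain ⟨p, -, hp, -⟩ := h0.1 ⟨0, by omega⟩
    obtain ⟨q, -, hq, -⟩ := h1.1 ⟨0, by omega⟩
    have hp' : ∀ i : Fin k, Linked (.inl p) (w i.succ) := hp ▸ h0.1
    have hq' : ∀ i : Fin k, Linked (.inl q) (w i.succ) := hq ▸ h1.1
    rw [hp] at hadj0 hne ⊢
    rw [hq] at hadj1 hne ⊢
    refine Linked.of_adj (fun hbase => hne ?_) hadj0.symm hadj1.symm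
    rw [eq_of_linked_of_base_eq hbase hadj0.symm hadj1.symm (fun i => w i.succ) h0.2 hnadj hp' hq']
  have heven : Even ({0} : Finset (Fin (k + 2))).card := by
    refine even_card_of_linked (by omega)
      (Fin.cons (f (origin 0)) (Fin.cons (f (origin 1)) fun i => w i.succ)) fun i j hij => ?_
    induction i using Fin.cases with
    | zero =>
      induction j using Fin.cases with
      | zero => exact absurd rfl hij
      | succ j =>
        induction j using Fin.cases with
        | zero => exact h01
        | succ j => exact h0.1 j
    | succ i =>
      induction i using Fin.cases with
      | zero =>
        induction j using Fin.cases with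
        | zero => exact h01.symm
        | succ j =>
          induction j using Fin.cases with
          | zero => exact absurd rfl hij
          | succ j => exact h1.1 j
      | succ i =>
        induction j using Fin.cases with
        | zero => exact (h0.1 i).symm
        | succ j =>
          induction j using Fin.cases with
          | zero => exact (h1.1 i).symm
          | succ j => exact h0.2 i j fun h => hij (by rw [h])
  simp at heven

end CFI

theorem mainTheorem7 (k r : ℕ) (hk : 2 ≤ k) (hr : 1 ≤ r) :
    -- the separating pair, built over the complete graph on `k + 2` vertices
    (∃ (G : MultiRelGraph r (CFIVertex (k + 2) ∅)) (H : MultiRelGraph r (CFIVertex (k + 2) {0})),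
      G = cfiMultiRel r (k + 2) ∅ ∧ H = cfiMultiRel r (k + 2) {0} ∧
      ¬ G.Isomorphic H ∧
      ¬ RLWLDistinguishes k G H ∧
      RLWLDistinguishes (k + 1) G H ∧
      (∀ (d₀ : ℕ) (ι : InitialEncoding k r d₀) (N : RN k r d₀), ¬ N.Distinguishes ι G H) ∧
      (∀ (d₀ : ℕ) (ι : InitialEncoding (k + 1) r d₀),
        ∃ N : RN (k + 1) r d₀, N.Distinguishes ι G H)) ∧
    -- nothing is lost when passing from `k` to `k + 1`
    (∀ (V W : Type) [Fintype V] [Fintype W] (G : MultiRelGraph r V) (H : MultiRelGraph r W),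
      (RLWLDistinguishes k G H → RLWLDistinguishes (k + 1) G H) ∧
      ((∃ (d₀ : ℕ) (ι : InitialEncoding k r d₀) (N : RN k r d₀), N.Distinguishes ι G H) →
        ∀ (d₀ : ℕ) (ι : InitialEncoding (k + 1) r d₀),
          ∃ N : RN (k + 1) r d₀, N.Distinguishes ι G H)) := by
  have hno := CFI.not_rlwlDistinguishes (n := k + 2) (k := k) (r := r) le_rfl
  have hyes := CFI.rlwlDistinguishes hk hr
  refine ⟨⟨_, _, rfl, rfl, fun h => h.not_rlwlDistinguishes hyes, hno, hyes,
    fun d₀ ι N h => hno h.rlwlDistinguishes, fun d₀ ι => RN.exists_distinguishes hyes ι⟩, ?_⟩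
  intro V W _ _ G H
  refine ⟨MultiRelGraph.rlwlDistinguishes_succ (by omega), ?_⟩
  rintro ⟨d₀, ι, N, h⟩ d₁ ι'
  exact RN.exists_distinguishes
    (MultiRelGraph.rlwlDistinguishes_succ (by omega) h.rlwlDistinguishes) ι'
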